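/- Let $\Delta\subset\mathbb C$ be the open unit disc and $b\Delta$ its boundary. Let $k,m\ge 0$ and $N\ge 1$ be integers, let $0<\alpha<1$, and let $G:b\Delta\to GL_N(\mathbb C)$ be smooth. Let $\mathcal C^{k,\alpha}$ be the space of real-valued functions of class $C^{k,\alpha}$ on $b\Delta$, and set $\mathcal C^{k,\alpha}_{\mathbb C}=\mathcal C^{k,\alpha}+i\,\mathcal C^{k,\alpha}$. Let $\mathcal A^{k,\alpha}$ be the space of continuous functions $f:\overline\Delta\to\mathbb C$ that are holomorphic on $\Delta$ and satisfy $f|_{b\Delta}\in\mathcal C^{k,\alpha}_{\mathbb C}$. Put $(1-\zeta)^m\mathcal A^{k,\alpha}=\{(1-\zeta)^m f : f\in\mathcal A^{k,\alpha}\}$, and let $\mathcal C^{k,\alpha}_{0^m}$ be the space of all $v\in\mathcal C^{k,\alpha}$ of the form $v=(1-\zeta)^m u$ with $u\in\mathcal C^{k,\alpha}_{\mathbb C}$. Consider the real-linear operator $$L:\big((1-\zeta)^m\mathcal A^{k,\alpha}\big)^N\to\big(\mathcal C^{k,\alpha}_{0^m}\big)^N,\qquad L(f)=2\,\mathrm{Re}\,[\,\overline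 G f\,]\big|_{b\Delta}.$$ Let $\kappa_1,\dots,\kappa_N\in\mathbb Z$ be the partial indices of $-\overline G^{-1}G$. This means that on $b\Delta$ $$-\overline{G(\zeta)}^{-1}G(\zeta)=B^+(\zeta)\,\mathrm{diag}(\zeta^{\kappa_1},\dots,\zeta^{\kappa_N})\,B^-(\zeta)$$ for some smooth maps $B^+:\overline\Delta\to GL_N(\mathbb C)$ and $B^-:(\mathbb C\cup\{\infty\})\setminus\Delta\to GL_N(\mathbb C)$ that are holomorphic on $\Delta$ and on $(\mathbb C\cup\{\infty\})\setminus\overline\Delta$, respectively. Suppose that $L$ is onto, and set $\ell_0=\max_{1\le\iota\le N}\kappa_\iota$. Then every $f\in\ker L$ is smooth up to the boundary, that is, each component of $f$ has continuous complex derivatives of all orders on $\overline\Delta$. Moreover, the map sending $f\in\ker L$ to its $\ell_0$-jet at $\zeta=1$, $$\mathfrak j_{\ell_0}(f)=\Big(f(1),\frac{\partial f}{\partial\zeta}(1),\dots,\frac{\partial^{\ell_0} f}{\partial\zeta^{\ell_0}}(1)\Big)\in\mathbb C^{N(\ell_0+1)},$$ is injective. (If $\ell_0=-1$, the jet is empty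 and the claim says that $\ker L=0$.) -/

import Mathlib

open scoped ContDiff ComplexConjugate Matrix

noncomputable section

namespace RiemannHilbert

/-- The closed unit disc, as a type. -/
abbrev ClosedDisc : Type := Metric.closedBall (0 : ℂ) 1

/-- A point of the unit circle, as a point of the closed disc. -/
def bdry (ζ : Circle) : ClosedDisc := ⟨(ζ : ℂ), by simp [Circle.norm_coe]⟩

/-- A function on the closed disc, extended by `0` to the plane. Below, it is only used through
its values on the closed disc (derivatives are taken within the closed disc, or in the open disc). -/
def ext0 (f : ClosedDisc → ℂ) : ℂ → ℂ := Function.extend Subtype.val f 0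

lemma ext0_apply (f : ClosedDisc → ℂ) {z : ℂ} (hz : z ∈ Metric.closedBall (0 : ℂ) 1) :
    ext0 f z = f ⟨z, hz⟩ :=
  Subtype.val_injective.extend_apply f 0 ⟨z, hz⟩

/-- The space of functions of class `C^{k,α}` on the unit circle with values in `E`: the function
`θ ↦ v (e^{iθ})` is of class `C^k` and its `k`-th derivative is `α`-Hölder for the distance
`|ζ - η|` of the circle. For `E = ℝ` this is `C^{k,α}`, for `E = ℂ` it is `C^{k,α} + i C^{k,α}`. -/
def holderSpace (k : ℕ) (α : ℝ) (E : Type) [NormedAddCommGroup E] [NormedSpace ℝ E] :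
    Submodule ℝ (Circle → E) where
  carrier := {v | ContDiff ℝ k (fun θ : ℝ => v (Circle.exp θ)) ∧
    ∃ C : ℝ, ∀ θ η : ℝ,
      ‖iteratedDeriv k (fun t : ℝ => v (Circle.exp t)) θ -
        iteratedDeriv k (fun t : ℝ => v (Circle.exp t)) η‖ ≤
      C * ‖(Circle.exp θ : ℂ) - (Circle.exp η : ℂ)‖ ^ α}
  add_mem' := by
    rintro u v ⟨hu, C, hC⟩ ⟨hv, D, hD⟩
    refine ⟨hu.add hv, C + D, fun θ η => ?_⟩
    have key : ∀ t : ℝ, iteratedDeriv k (fun t : ℝ => (u + v) (Circle.exp t)) t =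
        iteratedDeriv k (fun t : ℝ => u (Circle.exp t)) t +
        iteratedDeriv k (fun t : ℝ => v (Circle.exp t)) t := fun t =>
      iteratedDeriv_add hu.contDiffAt hv.contDiffAt
    rw [key, key, add_mul, add_sub_add_comm]
    exact (norm_add_le _ _).trans (add_le_add (hC θ η) (hD θ η))
  zero_mem' := by
    refine ⟨contDiff_const, 0, fun θ η => ?_⟩
    have h : (fun t : ℝ => (0 : Circle → E) (Circle.exp t)) = fun _ => 0 := rfl
    rw [h]
    simp
  smul_mem' := by
    rintro c v ⟨hv, D, hD⟩
    refine ⟨contDiff_const.smul hv, ‖c‖ * D, fun θ η => ?_⟩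
    have key : ∀ t : ℝ, iteratedDeriv k (fun t : ℝ => (c • v) (Circle.exp t)) t =
        c • iteratedDeriv k (fun t : ℝ => v (Circle.exp t)) t := fun t =>
      iteratedDeriv_const_smul_field c _
    rw [key, key, ← smul_sub, norm_smul, mul_assoc]
    exact mul_le_mul_of_nonneg_left (hD θ η) (norm_nonneg c)

/-- The space `A^{k,α}`: continuous functions on the closed disc, holomorphic on the open disc,
whose trace on the circle is of class `C^{k,α}`. -/
def discAlgebra (k : ℕ) (α : ℝ) : Submodule ℝ (ClosedDisc → ℂ) where
  carrier := {f | Continuous f ∧ DifferentiableOn ℂ (ext0 f) (Metric.ball 0 1) ∧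
    (fun ζ => f (bdry ζ)) ∈ holderSpace k α ℂ}
  add_mem' := by
    rintro f g ⟨hf, hf', hf''⟩ ⟨hg, hg', hg''⟩
    refine ⟨hf.add hg, (hf'.add hg').congr fun z hz => ?_, (holderSpace k α ℂ).add_mem hf'' hg''⟩
    have hz' := Metric.ball_subset_closedBall hz
    simp [ext0_apply _ hz']
  zero_mem' := by
    refine ⟨continuous_const, (differentiableOn_const (0 : ℂ)).congr fun z hz => ?_,
      (holderSpace k α ℂ).zero_mem⟩
    simp [ext0_apply _ (Metric.ball_subset_closedBall hz)]
  smul_mem' := by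
    rintro c f ⟨hf, hf', hf''⟩
    refine ⟨hf.const_smul c, (hf'.const_smul c).congr fun z hz => ?_,
      (holderSpace k α ℂ).smul_mem c hf''⟩
    have hz' := Metric.ball_subset_closedBall hz
    simp [ext0_apply _ hz']

/-- The space `(1 - ζ)^m A^{k,α}`. -/
def constrainedDiscAlgebra (m k : ℕ) (α : ℝ) : Submodule ℝ (ClosedDisc → ℂ) :=
  (discAlgebra k α).map
    (LinearMap.mulLeft ℝ (fun z : ClosedDisc => (1 - (z : ℂ)) ^ m))

/-- The space `C_{0^m}^{k,α}`: real functions in `C^{k,α}` of the form `(1 - ζ)^m u` with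
`u` a complex function of class `C^{k,α}`. -/
def constrainedHolder (m k : ℕ) (α : ℝ) : Submodule ℝ (Circle → ℝ) where
  carrier := {v | v ∈ holderSpace k α ℝ ∧
    ∃ u ∈ holderSpace k α ℂ, ∀ ζ : Circle, (v ζ : ℂ) = (1 - (ζ : ℂ)) ^ m * u ζ}
  add_mem' := by
    rintro v w ⟨hv, u, hu, huv⟩ ⟨hw, u', hu', huw⟩
    refine ⟨add_mem hv hw, u + u', add_mem hu hu', fun ζ => ?_⟩
    simp only [Pi.add_apply, Complex.ofReal_add, huv, huw, mul_add]
  zero_mem' := ⟨zero_mem _, 0, zero_mem _, fun ζ => by simp⟩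
  smul_mem' := by
    rintro c v ⟨hv, u, hu, huv⟩
    refine ⟨Submodule.smul_mem _ c hv, c • u, Submodule.smul_mem _ c hu, fun ζ => ?_⟩
    simp only [Pi.smul_apply, smul_eq_mul, Complex.ofReal_mul, huv, Complex.real_smul]
    ring

/-- The source `((1 - ζ)^m A^{k,α})^N` of the operator. -/
def source (N m k : ℕ) (α : ℝ) : Submodule ℝ (Fin N → ClosedDisc → ℂ) :=
  Submodule.pi Set.univ fun _ => constrainedDiscAlgebra m k α

/-- The target `(C_{0^m}^{k,α})^N` of the operator. -/
def target (N m k : ℕ) (α : ℝ) : Submodule ℝ (Fin N → Circle → ℝ) :=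
  Submodule.pi Set.univ fun _ => constrainedHolder m k α

/-- A map from the circle to `GL_N(ℂ)` is smooth. -/
def SmoothOnCircle {N : ℕ} (G : Circle → GL (Fin N) ℂ) : Prop :=
  ∀ i j, ContDiff ℝ ∞ fun θ : ℝ => (G (Circle.exp θ) : Matrix (Fin N) (Fin N) ℂ) i j

/-- The complex conjugate (entry by entry, not transposed) of `G`. -/
def conjMat {N : ℕ} (G : Circle → GL (Fin N) ℂ) (ζ : Circle) : Matrix (Fin N) (Fin N) ℂ :=
  (G ζ : Matrix (Fin N) (Fin N) ℂ).map conj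

/-- The expression `f ↦ 2 Re [conj(G) f]` on the circle. -/
def rhOperator {N : ℕ} (G : Circle → GL (Fin N) ℂ) :
    (Fin N → ClosedDisc → ℂ) →ₗ[ℝ] (Fin N → Circle → ℝ) where
  toFun f := fun i ζ => 2 * ((conjMat G ζ *ᵥ fun j => f j (bdry ζ)) i).re
  map_add' f g := by
    funext i ζ
    have h : (fun j => (f + g) j (bdry ζ)) =
        (fun j => f j (bdry ζ)) + fun j => g j (bdry ζ) := rfl
    change 2 * ((conjMat G ζ *ᵥ fun j => (f + g) j (bdry ζ)) i).re = _
    rw [h, Matrix.mulVec_add, Pi.add_apply, Complex.add_re, mul_add]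
    rfl
  map_smul' c f := by
    funext i ζ
    have h : (fun j => (c • f) j (bdry ζ)) = c • fun j => f j (bdry ζ) := rfl
    change 2 * ((conjMat G ζ *ᵥ fun j => (c • f) j (bdry ζ)) i).re =
      c * (2 * ((conjMat G ζ *ᵥ fun j => f j (bdry ζ)) i).re)
    rw [h, Matrix.mulVec_smul, Pi.smul_apply, Complex.smul_re, smul_eq_mul]
    ring

/-- The operator `L : ((1 - ζ)^m A^{k,α})^N → (C_{0^m}^{k,α})^N`, `L f = 2 Re [conj(G) f]`,
is onto. -/
def IsOnto {N : ℕ} (m k : ℕ) (α : ℝ) (G : Circle → GL (Fin N) ℂ) : Prop :=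
  Set.SurjOn (rhOperator G) (source N m k α) (target N m k α)

/-- The kernel of `L`. -/
def kerL {N : ℕ} (m k : ℕ) (α : ℝ) (G : Circle → GL (Fin N) ℂ) :
    Submodule ℝ (Fin N → ClosedDisc → ℂ) :=
  source N m k α ⊓ LinearMap.ker (rhOperator G)

/-- `B` is, on the closed disc, a smooth map to `GL_N(ℂ)` that is holomorphic on the open disc. -/
structure IsPlusFactor {N : ℕ} (B : ℂ → Matrix (Fin N) (Fin N) ℂ) : Prop where
  smooth : ∀ i j, ContDiffOn ℝ ∞ (fun z => B z i j) (Metric.closedBall 0 1)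
  holomorphic : ∀ i j, DifferentiableOn ℂ (fun z => B z i j) (Metric.ball 0 1)
  invertible : ∀ z ∈ Metric.closedBall (0 : ℂ) 1, IsUnit (B z)

/-- The inversion `w ↦ 1 / w` from the plane to the Riemann sphere. It identifies the closed disc
with the complement of the open disc in the sphere. -/
def sphereInv (w : ℂ) : OnePoint ℂ := if w = 0 then OnePoint.infty else ((w⁻¹ : ℂ) : OnePoint ℂ)

/-- `B` is, on the complement of the open disc in the Riemann sphere, a smooth map to `GL_N(ℂ)`
that is holomorphic on the complement of the closed disc (read in the coordinate `w = 1 / z`). -/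
def IsMinusFactor {N : ℕ} (B : OnePoint ℂ → Matrix (Fin N) (Fin N) ℂ) : Prop :=
  IsPlusFactor fun w => B (sphereInv w)

/-- The integers `κ` are the partial indices of `F`, a map from the circle to invertible matrices:
they are the exponents in a Birkhoff factorization of `F`. -/
def IsPartialIndices {N : ℕ} (F : Circle → Matrix (Fin N) (Fin N) ℂ) (κ : Fin N → ℤ) : Prop :=
  ∃ (Bp : ℂ → Matrix (Fin N) (Fin N) ℂ) (Bm : OnePoint ℂ → Matrix (Fin N) (Fin N) ℂ),
    IsPlusFactor Bp ∧ IsMinusFactor Bm ∧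
    ∀ ζ : Circle, F ζ =
      Bp (ζ : ℂ) * Matrix.diagonal (fun j => (ζ : ℂ) ^ κ j) * Bm (((ζ : ℂ)) : OnePoint ℂ)

/-- The `ℓ₀`-jet at `1` of an `N`-tuple of functions on the closed disc: the complex derivatives at
`1`, within the closed disc, of orders `0 ≤ ℓ ≤ ℓ₀` (no entry at all if `ℓ₀ < 0`). -/
def jetAtOne {N : ℕ} (ℓ₀ : ℤ) (f : Fin N → ClosedDisc → ℂ) :
    {ℓ : ℕ // (ℓ : ℤ) ≤ ℓ₀} → Fin N → ℂ :=
  fun ℓ j => iteratedDerivWithin ℓ.1 (ext0 (f j)) (Metric.closedBall 0 1) 1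

end RiemannHilbert

end

open Metric Set Filter Topology

namespace RiemannHilbert

/-! For `f` in the kernel, the boundary condition reads `f = -conj(G)⁻¹ G conj(f)` on the circle.
Inserting the Birkhoff factorization, each component of `(B⁺)⁻¹ f` equals `ζ ^ κ j` times the same
component of `B⁻ conj(f)`. The left side extends holomorphically to the disc, while `B⁻ conj(f)`
extends holomorphically to the exterior, so only the Fourier modes `0, ..., κ j` survive
(`exists_polynomial_of_eq_zpow_mul`). Hence `f = B⁺ P` with `P` polynomial and `deg P j ≤ κ j`
(`exists_polynomial_of_mem_kerL`), and `f` inherits the smoothness of `B⁺`. If the `ℓ₀`-jet of `f`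
at `1` vanishes, the Leibniz rule makes the jet of `P = (B⁺)⁻¹ f` vanish too
(`iteratedDerivWithin_mul_eq_zero`). A polynomial of degree at most `ℓ₀` with zero `ℓ₀`-jet is zero
(`polynomial_eq_zero_of_jet`), so `f = 0`. -/

/-! ### From real to complex smoothness on the closed disc. -/

lemma uniqueDiffOn_real_closedBall : UniqueDiffOn ℝ (closedBall (0 : ℂ) 1) :=
  uniqueDiffOn_convex (convex_closedBall 0 1)
    (by rw [interior_closedBall _ one_ne_zero]; exact ⟨0, by simp⟩)

lemma uniqueDiffOn_closedBall : UniqueDiffOn ℂ (closedBall (0 : ℂ) 1) :=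
  uniqueDiffOn_real_closedBall.mono_field

/-- The real derivative of a holomorphic function that is `C^1` up to the boundary is complex
linear on the closed disc. -/
lemma fderivWithin_apply_of_holomorphic {F : ℂ → ℂ} (hF : ContDiffOn ℝ 1 F (closedBall 0 1))
    (hd : DifferentiableOn ℂ F (ball 0 1)) {z : ℂ} (hz : z ∈ closedBall (0 : ℂ) 1) (v : ℂ) :
    fderivWithin ℝ F (closedBall 0 1) z v = v * fderivWithin ℝ F (closedBall 0 1) z 1 := by
  have hc : ContinuousOn (fderivWithin ℝ F (closedBall 0 1)) (closedBall 0 1) :=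
    hF.continuousOn_fderivWithin uniqueDiffOn_real_closedBall le_rfl
  have h1 : ContinuousOn (fun z => fderivWithin ℝ F (closedBall 0 1) z v) (closedBall 0 1) :=
    hc.clm_apply continuousOn_const
  have h2 : ContinuousOn (fun z => v * fderivWithin ℝ F (closedBall 0 1) z 1) (closedBall 0 1) :=
    continuousOn_const.mul (hc.clm_apply continuousOn_const)
  -- Cauchy–Riemann holds in the open disc; both sides are continuous on its closure.
  have heq : EqOn (fun z => fderivWithin ℝ F (closedBall 0 1) z v)
      (fun z => v * fderivWithin ℝ F (closedBall 0 1) z 1) (ball 0 1) := by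
    intro w hw
    have hw' : closedBall (0 : ℂ) 1 ∈ 𝓝 w := mem_of_superset (isOpen_ball.mem_nhds hw)
      ball_subset_closedBall
    have hdw : DifferentiableAt ℂ F w := hd.differentiableAt (isOpen_ball.mem_nhds hw)
    have : fderivWithin ℝ F (closedBall 0 1) w = (fderiv ℂ F w).restrictScalars ℝ := by
      rw [fderivWithin_of_mem_nhds hw']
      exact (hdw.hasFDerivAt.restrictScalars ℝ).fderiv
    simp only [this, ContinuousLinearMap.coe_restrictScalars']
    rw [← smul_eq_mul, ← map_smul, smul_eq_mul, mul_one]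
  exact heq.of_subset_closure h1 h2 ball_subset_closedBall
    (by rw [closure_ball _ one_ne_zero]) hz

/-- The little-o estimate is the same over `ℝ` and `ℂ`, so complex linearity of the real derivative
suffices, even at boundary points. -/
lemma hasDerivWithinAt_of_holomorphic {F : ℂ → ℂ} (hF : ContDiffOn ℝ 1 F (closedBall 0 1))
    (hd : DifferentiableOn ℂ F (ball 0 1)) {z : ℂ} (hz : z ∈ closedBall (0 : ℂ) 1) :
    HasDerivWithinAt F (fderivWithin ℝ F (closedBall 0 1) z 1) (closedBall 0 1) z := by
  have h := (hF.differentiableOn one_ne_zero z hz).hasFDerivWithinAt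
  rw [hasDerivWithinAt_iff_hasFDerivWithinAt]
  refine HasFDerivWithinAt.of_isLittleO ?_
  refine h.isLittleO.congr_left fun w => ?_
  rw [fderivWithin_apply_of_holomorphic hF hd hz (w - z)]
  simp

/-- A function that is smooth on the closed disc in the real sense and holomorphic inside has
continuous complex derivatives of all orders on the closed disc. -/
lemma contDiffOn_complex_of_holomorphic {F : ℂ → ℂ} (hF : ContDiffOn ℝ ∞ F (closedBall 0 1))
    (hd : DifferentiableOn ℂ F (ball 0 1)) : ContDiffOn ℂ ∞ F (closedBall 0 1) := by
  rw [contDiffOn_infty]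
  intro n
  induction n generalizing F with
  | zero => exact contDiffOn_zero.2 hF.continuousOn
  | succ n ih =>
    have hF1 : ContDiffOn ℝ 1 F (closedBall 0 1) := hF.of_le (by norm_cast)
    have hder : EqOn (derivWithin F (closedBall 0 1))
        (fun z => fderivWithin ℝ F (closedBall 0 1) z 1) (closedBall 0 1) := fun z hz =>
      (hasDerivWithinAt_of_holomorphic hF1 hd hz).derivWithin (uniqueDiffOn_closedBall z hz)
    push_cast
    rw [contDiffOn_succ_iff_derivWithin uniqueDiffOn_closedBall]
    refine ⟨fun z hz => (hasDerivWithinAt_of_holomorphic hF1 hd hz).differentiableWithinAt,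
      by simp, ih ?_ ?_⟩
    · refine ContDiffOn.congr ?_ hder
      exact (hF.fderivWithin uniqueDiffOn_real_closedBall (by simp)).clm_apply contDiffOn_const
    · refine (hd.deriv isOpen_ball).congr fun z hz => ?_
      exact derivWithin_of_mem_nhds (mem_of_superset (isOpen_ball.mem_nhds hz)
        ball_subset_closedBall)

/-! ### Matching Fourier modes on the circle. -/

/-- Substitution `ζ ↦ ζ⁻¹` in an integral over the unit circle. -/
lemma circleIntegral_inv (f : ℂ → ℂ) :
    (∮ z in C(0, 1), z⁻¹ ^ 2 * f z⁻¹) = ∮ z in C(0, 1), f z := by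
  simp only [circleIntegral, deriv_circleMap, smul_eq_mul, circleMap_zero_inv, inv_one]
  have hper : Function.Periodic
      (fun θ : ℝ => circleMap 0 1 θ * Complex.I * f (circleMap 0 1 θ)) (2 * Real.pi) := by
    intro θ
    simp only [(periodic_circleMap 0 1) θ]
  have h : ∀ θ : ℝ, circleMap 0 1 θ * Complex.I *
      (circleMap 0 1 (-θ) ^ 2 * f (circleMap 0 1 (-θ))) =
      (fun θ : ℝ => circleMap 0 1 θ * Complex.I * f (circleMap 0 1 θ)) (-θ) := by
    intro θ
    have h1 : circleMap 0 1 θ * circleMap 0 1 (-θ) = 1 := by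
      rw [← inv_one, ← circleMap_zero_inv, inv_one]
      exact mul_inv_cancel₀ (circleMap_ne_center one_ne_zero)
    simp only
    linear_combination Complex.I * circleMap 0 1 (-θ) * f (circleMap 0 1 (-θ)) * h1
  simp only [h]
  rw [intervalIntegral.integral_comp_neg
    (fun θ : ℝ => circleMap 0 1 θ * Complex.I * f (circleMap 0 1 θ))]
  -- `θ ↦ -θ` moves the interval to `[-2π, 0]`; periodicity moves it back.
  have := hper.intervalIntegral_add_eq (-(2 * Real.pi)) 0
  simpa using this

open Polynomial in
/-- If `h` and `p` are holomorphic on the disc and continuous up to the boundary, and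
`h(ζ) = ζ ^ κ p(1 / ζ)` on the circle, then `h` is a polynomial of degree at most `κ`. -/
lemma exists_polynomial_of_eq_zpow_mul {h p : ℂ → ℂ} (hh : DiffContOnCl ℂ h (ball 0 1))
    (hp : DiffContOnCl ℂ p (ball 0 1)) (κ : ℤ)
    (heq : ∀ z : ℂ, ‖z‖ = 1 → h z = z ^ κ * p z⁻¹) :
    ∃ P : ℂ[X], (∀ n : ℕ, κ < n → P.coeff n = 0) ∧
      ∀ z ∈ closedBall (0 : ℂ) 1, h z = P.eval z := by
  have hvanish : ∀ n : ℕ, κ < n → (∮ z in C(0, 1), (z⁻¹ ^ n * (z⁻¹ * h z))) = 0 := by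
    intro n hn
    -- With `w = z⁻¹`, the integrand `z ^ (-n - 1) * z ^ κ * p z⁻¹` becomes `w ^ 2 * (w ^ l * p w)`.
    -- Here `l ≥ 0` exactly because `n > κ`, so Cauchy's theorem applies after inversion.
    obtain ⟨l, hl⟩ : ∃ l : ℕ, (n : ℤ) = κ + 1 + l := ⟨(n - κ - 1).toNat, by omega⟩
    have h1 : (∮ z in C(0, 1), (z⁻¹ ^ n * (z⁻¹ * h z))) =
        ∮ z in C(0, 1), z⁻¹ ^ 2 * (fun w => w ^ l * p w) z⁻¹ := by
      refine circleIntegral.integral_congr zero_le_one fun z hz => ?_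
      have hz1 : ‖z‖ = 1 := by simpa using hz
      have hz0 : z ≠ 0 := by rintro rfl; simp at hz1
      simp only
      rw [heq z hz1]
      have : z⁻¹ ^ n = z ^ (-(κ + 1 + l)) := by rw [← hl]; simp
      rw [this, neg_add, neg_add, zpow_add₀ hz0, zpow_add₀ hz0, zpow_neg z κ, zpow_neg_one,
        zpow_neg z l, zpow_natCast]
      have := zpow_ne_zero κ hz0
      have := pow_ne_zero l hz0
      simp only [inv_pow]
      field_simp
    rw [h1, circleIntegral_inv fun w => w ^ l * p w]
    refine DiffContOnCl.circleIntegral_eq_zero zero_le_one ?_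
    exact (((differentiable_id.pow l).diffContOnCl).smul hp)
  have hps := hh.hasFPowerSeriesOnBall (R := 1) one_pos
  set c : ℕ → ℂ := fun n => (2 * Real.pi * Complex.I : ℂ)⁻¹ *
    ∮ z in C(0, 1), (z⁻¹ ^ n * (z⁻¹ * h z)) with hc
  have hc0 : ∀ n : ℕ, κ < n → c n = 0 := fun n hn => by simp only [hc, hvanish n hn, mul_zero]
  have hsum : ∀ z ∈ ball (0 : ℂ) 1, HasSum (fun n => c n * z ^ n) (h z) := by
    intro z hz
    have := hps.hasSum (y := z) (by simpa [enorm_eq_nnnorm, ← NNReal.coe_lt_coe] using hz)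
    convert! this using 2 with n
    · simp [cauchyPowerSeries, hc, mul_comm]
    · simp
  -- For `κ < 0` the truncation `toNat` gives an empty sum, so `P = 0`.
  refine ⟨∑ n ∈ Finset.range (κ + 1).toNat, monomial n (c n), fun n hn => ?_, ?_⟩
  · rw [finsetSum_coeff]
    refine Finset.sum_eq_zero fun i _ => ?_
    rw [coeff_monomial]
    split_ifs with hi
    · subst hi; exact hc0 _ hn
    · rfl
  · have hball : EqOn h (fun z => (∑ n ∈ Finset.range (κ + 1).toNat, monomial n (c n)).eval z)
        (ball 0 1) := by
      intro z hz
      refine (hsum z hz).unique ?_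
      simp only [eval_finsetSum, eval_monomial]
      refine hasSum_sum_of_ne_finset_zero fun n hn => ?_
      rw [hc0 n (by simp at hn; omega), zero_mul]
    have hcl : ContinuousOn h (closedBall 0 1) := hh.continuousOn_ball
    exact hball.of_subset_closure hcl (Polynomial.continuous _).continuousOn
      ball_subset_closedBall (by rw [closure_ball _ one_ne_zero])

/-! ### Jets of products and of polynomials. -/

/-- If the jet of `f` at `x` vanishes up to order `n`, then so does the jet of `a f`. -/
lemma iteratedDerivWithin_mul_eq_zero {s : Set ℂ} (hs : UniqueDiffOn ℂ s) {x : ℂ} (hx : x ∈ s)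
    (i : ℕ) {a f : ℂ → ℂ} (ha : ContDiffOn ℂ ∞ a s) (hf : ContDiffOn ℂ ∞ f s)
    (h : ∀ l ≤ i, iteratedDerivWithin l f s x = 0) :
    iteratedDerivWithin i (fun z => a z * f z) s x = 0 := by
  induction i generalizing a f with
  | zero => simpa using Or.inr (h 0 le_rfl)
  | succ i ih =>
    have ha' : ContDiffOn ℂ ∞ (derivWithin a s) s := ha.derivWithin hs (by simp)
    have hf' : ContDiffOn ℂ ∞ (derivWithin f s) s := hf.derivWithin hs (by simp)
    have hle : ((i : ℕ∞) : WithTop ℕ∞) ≤ ∞ := by norm_cast; exact le_top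
    rw [iteratedDerivWithin_succ']
    have hder : EqOn (derivWithin (fun z => a z * f z) s)
        (fun z => derivWithin a s z * f z + a z * derivWithin f s z) s := fun z hz =>
      derivWithin_fun_mul (ha.differentiableOn (by simp) z hz) (hf.differentiableOn (by simp) z hz)
    rw [iteratedDerivWithin_congr hder hx, iteratedDerivWithin_fun_add hx hs
      (((ha'.mul hf).of_le hle) x hx) (((ha.mul hf').of_le hle) x hx),
      ih ha' hf fun l hl => h l (by omega),
      ih ha hf' fun l hl => ?_, add_zero]
    rw [← iteratedDerivWithin_succ']
    exact h (l + 1) (by omega)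

open Polynomial in
lemma iteratedDerivWithin_polynomial_eval {s : Set ℂ} (hs : UniqueDiffOn ℂ s) {x : ℂ} (hx : x ∈ s)
    (i : ℕ) (P : ℂ[X]) :
    iteratedDerivWithin i (fun z => P.eval z) s x = (derivative^[i] P).eval x := by
  induction i generalizing P with
  | zero => simp
  | succ i ih =>
    rw [iteratedDerivWithin_succ', Function.iterate_succ_apply, ← ih]
    exact iteratedDerivWithin_congr (fun z hz => P.derivWithin (hs z hz)) hx

open Polynomial in
/-- A polynomial of degree at most `d` is determined by its `d`-jet at a point. -/
lemma polynomial_eq_zero_of_jet {P : ℂ[X]} {d : ℤ} (hP : ∀ n : ℕ, d < n → P.coeff n = 0) (x : ℂ)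
    (h : ∀ l : ℕ, (l : ℤ) ≤ d → (derivative^[l] P).eval x = 0) : P = 0 := by
  -- Hasse derivatives are the Taylor coefficients at `x`: those of order at most `d` vanish by the
  -- jet, the others by the degree bound.
  refine eq_zero_of_hasseDeriv_eq_zero P x fun l => ?_
  by_cases hl : (l : ℤ) ≤ d
  · have := h l hl
    rw [← factorial_smul_hasseDeriv] at this
    simpa [Nat.factorial_ne_zero] using this
  · have : hasseDeriv l P = 0 := by
      ext n
      rw [hasseDeriv_coeff, hP _ (by push_cast; omega), mul_zero, coeff_zero]
    rw [this, eval_zero]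

/-! ### Regularity of the matrix factors and of the boundary data. -/

lemma contDiffOn_det {ι : Type*} [Fintype ι] [DecidableEq ι] {s : Set ℂ} {n : WithTop ℕ∞}
    {B : ℂ → Matrix ι ι ℂ} (hB : ∀ i j, ContDiffOn ℂ n (fun z => B z i j) s) :
    ContDiffOn ℂ n (fun z => (B z).det) s := by
  simp only [Matrix.det_apply]
  exact ContDiffOn.sum fun σ _ => (contDiffOn_prod fun i _ => hB (σ i) i).const_smul _

lemma contDiffOn_matrix_inv {ι : Type*} [Fintype ι] [DecidableEq ι] {s : Set ℂ} {n : WithTop ℕ∞}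
    {B : ℂ → Matrix ι ι ℂ} (hB : ∀ i j, ContDiffOn ℂ n (fun z => B z i j) s)
    (hu : ∀ z ∈ s, IsUnit (B z)) (i j : ι) : ContDiffOn ℂ n (fun z => (B z)⁻¹ i j) s := by
  -- Cramer's rule: the inverse is a quotient of determinants in the entries of `B`.
  have h : ∀ z, (B z)⁻¹ i j =
      ((B z).det)⁻¹ * ((B z).updateRow j (Pi.single i 1)).det := by
    intro z
    rw [Matrix.inv_def, Matrix.smul_apply, Ring.inverse_eq_inv', Matrix.adjugate_apply, smul_eq_mul]
  simp only [h]
  refine ((contDiffOn_det hB).inv fun z hz => ?_).mul (contDiffOn_det fun a b => ?_)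
  · exact ((Matrix.isUnit_iff_isUnit_det _).1 (hu z hz)).ne_zero
  · by_cases ha : a = j
    · subst ha
      simpa using contDiffOn_const
    · simpa [Matrix.updateRow_ne ha] using hB a b

lemma diffContOnCl_of_contDiffOn {F : ℂ → ℂ} (h : ContDiffOn ℂ ∞ F (closedBall 0 1)) :
    DiffContOnCl ℂ F (ball 0 1) :=
  ⟨(h.differentiableOn (by simp)).mono ball_subset_closedBall, by
    rw [closure_ball _ one_ne_zero]; exact h.continuousOn⟩

/-- Schwarz reflection: on the circle `conj w = w⁻¹`, so this turns `conj (f ζ)` into the boundary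
value of a function holomorphic in `w = ζ⁻¹`. -/
lemma diffContOnCl_conj_conj {F : ℂ → ℂ} (h : DiffContOnCl ℂ F (ball 0 1)) :
    DiffContOnCl ℂ (fun z => conj (F (conj z))) (ball 0 1) := by
  refine ⟨fun z hz => ?_, ?_⟩
  · have hz' : conj z ∈ ball (0 : ℂ) 1 := by simpa using hz
    have := (h.differentiableAt isOpen_ball hz').conj_conj
    rw [Complex.conj_conj] at this
    exact this.differentiableWithinAt
  · have hc := h.continuousOn
    rw [closure_ball _ one_ne_zero] at hc ⊢
    exact Complex.continuous_conj.comp_continuousOn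
      (hc.comp Complex.continuous_conj.continuousOn fun z hz => by simpa using hz)

lemma diffContOnCl_mulVec {ι : Type*} [Fintype ι] {A : ℂ → Matrix ι ι ℂ} {v : ℂ → ι → ℂ}
    (hA : ∀ i j, DiffContOnCl ℂ (fun z => A z i j) (ball 0 1))
    (hv : ∀ j, DiffContOnCl ℂ (fun z => v z j) (ball 0 1)) (i : ι) :
    DiffContOnCl ℂ (fun z => (A z *ᵥ v z) i) (ball 0 1) := by
  simp only [Matrix.mulVec, dotProduct]
  exact ⟨DifferentiableOn.fun_sum fun j _ => (hA i j).differentiableOn.mul (hv j).differentiableOn,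
    continuousOn_finsetSum _ fun j _ => (hA i j).continuousOn.mul (hv j).continuousOn⟩

lemma IsPlusFactor.contDiffOn {N : ℕ} {B : ℂ → Matrix (Fin N) (Fin N) ℂ} (hB : IsPlusFactor B)
    (i j : Fin N) : ContDiffOn ℂ ∞ (fun z => B z i j) (closedBall 0 1) :=
  contDiffOn_complex_of_holomorphic (hB.smooth i j) (hB.holomorphic i j)

lemma diffContOnCl_ext0 {N m k : ℕ} {α : ℝ} {f : Fin N → ClosedDisc → ℂ}
    (hf : f ∈ source N m k α) (j : Fin N) : DiffContOnCl ℂ (ext0 (f j)) (ball 0 1) := by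
  obtain ⟨g, ⟨hgc, hgd, -⟩, hg⟩ := hf j (mem_univ j)
  have hfg : ∀ z (hz : z ∈ closedBall (0 : ℂ) 1), ext0 (f j) z = (1 - z) ^ m * ext0 g z := by
    intro z hz
    rw [ext0_apply _ hz, ext0_apply _ hz, ← hg]
    rfl
  have hgcl : ContinuousOn (ext0 g) (closedBall 0 1) := by
    rw [continuousOn_iff_continuous_domRestrict]
    refine hgc.congr fun z => ?_
    rw [domRestrict_apply, ext0_apply _ z.2]
  have hpow : Differentiable ℂ fun z : ℂ => (1 - z) ^ m := by fun_prop
  refine ⟨(hpow.differentiableOn.mul hgd).congr fun z hz =>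
    hfg z (ball_subset_closedBall hz), ?_⟩
  rw [closure_ball _ one_ne_zero]
  exact (hpow.continuous.continuousOn.mul hgcl).congr hfg

lemma ext0_sub (f g : ClosedDisc → ℂ) {z : ℂ} (hz : z ∈ closedBall (0 : ℂ) 1) :
    ext0 (f - g) z = ext0 f z - ext0 g z := by
  simp [ext0_apply _ hz]

/-! ### The kernel in terms of the Birkhoff factorization. -/

lemma isUnit_conjMat {N : ℕ} (G : Circle → GL (Fin N) ℂ) (ζ : Circle) : IsUnit (conjMat G ζ) :=
  (G ζ).isUnit.map (RingHom.mapMatrix (starRingEnd ℂ))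

/-- The boundary condition `2 Re [conj(G) f] = 0`, solved for `f`. -/
lemma boundary_relation {N : ℕ} {G : Circle → GL (Fin N) ℂ} {f : Fin N → ClosedDisc → ℂ}
    (hf : f ∈ LinearMap.ker (rhOperator G)) (ζ : Circle) :
    (fun j => f j (bdry ζ)) =
      (-((conjMat G ζ)⁻¹ * (G ζ : Matrix (Fin N) (Fin N) ℂ))) *ᵥ fun j => conj (f j (bdry ζ)) := by
  have h : conjMat G ζ *ᵥ (fun j => f j (bdry ζ)) =
      -((G ζ : Matrix (Fin N) (Fin N) ℂ) *ᵥ fun j => conj (f j (bdry ζ))) := by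
    funext i
    have h0 : 2 * ((conjMat G ζ *ᵥ fun j => f j (bdry ζ)) i).re = 0 :=
      congrFun (congrFun (LinearMap.mem_ker.1 hf) i) ζ
    have h1 : conj ((conjMat G ζ *ᵥ fun j => f j (bdry ζ)) i) =
        ((G ζ : Matrix (Fin N) (Fin N) ℂ) *ᵥ fun j => conj (f j (bdry ζ))) i := by
      simp [Matrix.mulVec, dotProduct, conjMat]
    rw [Pi.neg_apply, ← h1, eq_neg_iff_add_eq_zero, Complex.add_conj]
    rw [h0, Complex.ofReal_zero]
  have hdet : IsUnit (conjMat G ζ).det := (Matrix.isUnit_iff_isUnit_det _).1 (isUnit_conjMat G ζ)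
  rw [Matrix.neg_mulVec, ← Matrix.mulVec_mulVec, ← Matrix.mulVec_neg, ← h, Matrix.mulVec_mulVec,
    Matrix.nonsing_inv_mul _ hdet, Matrix.one_mulVec]

open Polynomial in
/-- Elements of the kernel are of the form `B⁺ P`, where the components of `P` are polynomials
whose degrees are bounded by the partial indices. -/
lemma exists_polynomial_of_mem_kerL {N m k : ℕ} {α : ℝ} {G : Circle → GL (Fin N) ℂ}
    {κ : Fin N → ℤ} {Bp : ℂ → Matrix (Fin N) (Fin N) ℂ} {Bm : OnePoint ℂ → Matrix (Fin N) (Fin N) ℂ}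
    (hBp : IsPlusFactor Bp) (hBm : IsMinusFactor Bm)
    (hfac : ∀ ζ : Circle, -((conjMat G ζ)⁻¹ * (G ζ : Matrix (Fin N) (Fin N) ℂ)) =
      Bp (ζ : ℂ) * Matrix.diagonal (fun j => (ζ : ℂ) ^ κ j) * Bm (((ζ : ℂ)) : OnePoint ℂ))
    {f : Fin N → ClosedDisc → ℂ} (hf : f ∈ kerL m k α G) :
    ∃ P : Fin N → ℂ[X], (∀ j, ∀ n : ℕ, κ j < n → (P j).coeff n = 0) ∧
      ∀ z ∈ closedBall (0 : ℂ) 1,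
        ((Bp z)⁻¹ *ᵥ fun j => ext0 (f j) z) = fun j => (P j).eval z := by
  have hF := diffContOnCl_ext0 hf.1
  set h : Fin N → ℂ → ℂ := fun j z => ((Bp z)⁻¹ *ᵥ fun i => ext0 (f i) z) j with h_def
  -- This is `B⁻ conj(f)` on the exterior, read in the coordinate `w = 1 / z`.
  set p : Fin N → ℂ → ℂ := fun j w =>
    (Bm (sphereInv w) *ᵥ fun i => conj (ext0 (f i) (conj w))) j with p_def
  have hh : ∀ j, DiffContOnCl ℂ (h j) (ball 0 1) := diffContOnCl_mulVec
    (fun i j => diffContOnCl_of_contDiffOn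
      (contDiffOn_matrix_inv hBp.contDiffOn hBp.invertible i j)) hF
  have hp : ∀ j, DiffContOnCl ℂ (p j) (ball 0 1) := diffContOnCl_mulVec
    (fun i j => diffContOnCl_of_contDiffOn (IsPlusFactor.contDiffOn hBm i j))
    fun j => diffContOnCl_conj_conj (hF j)
  have heq : ∀ j, ∀ z : ℂ, ‖z‖ = 1 → h j z = z ^ κ j * p j z⁻¹ := by
    intro j z hz
    have hz0 : z ≠ 0 := by rintro rfl; simp at hz
    have hzc : z ∈ closedBall (0 : ℂ) 1 := by simp [hz]
    have hinv : conj z⁻¹ = z := by rw [Complex.inv_eq_conj hz, Complex.conj_conj]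
    obtain ⟨ζ, rfl⟩ : ∃ ζ : Circle, (ζ : ℂ) = z :=
      ⟨⟨z, by simpa [Submonoid.unitSphere] using hz⟩, rfl⟩
    have hval : ∀ i, f i (bdry ζ) = ext0 (f i) ζ := fun i => (ext0_apply _ hzc).symm
    have hrel := boundary_relation hf.2 ζ
    rw [hfac ζ] at hrel
    simp only [hval] at hrel
    have hdet : IsUnit (Bp ζ).det :=
      (Matrix.isUnit_iff_isUnit_det _).1 (hBp.invertible _ hzc)
    have hs : sphereInv (ζ : ℂ)⁻¹ = ((ζ : ℂ) : OnePoint ℂ) := by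
      rw [sphereInv, if_neg (inv_ne_zero hz0), inv_inv]
    simp only [h_def, p_def, hs, hinv]
    rw [hrel, Matrix.mul_assoc, Matrix.mulVec_mulVec, ← Matrix.mul_assoc,
      Matrix.nonsing_inv_mul _ hdet, Matrix.one_mul, ← Matrix.mulVec_mulVec,
      Matrix.mulVec_diagonal]
  choose P hP hPe using fun j =>
    exists_polynomial_of_eq_zpow_mul (hh j) (hp j) (κ j) (heq j)
  exact ⟨P, hP, fun z hz => funext fun j => hPe j z hz⟩

lemma eq_mulVec_of_inv_mulVec_eq {ι : Type*} [Fintype ι] [DecidableEq ι] {B : Matrix ι ι ℂ}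
    (hB : IsUnit B) {v w : ι → ℂ} (h : B⁻¹ *ᵥ v = w) : v = B *ᵥ w := by
  rw [← h, Matrix.mulVec_mulVec, Matrix.mul_nonsing_inv _ ((Matrix.isUnit_iff_isUnit_det _).1 hB),
    Matrix.one_mulVec]

/-- Elements of the kernel are smooth up to the boundary. -/
lemma contDiffOn_of_mem_kerL {N m k : ℕ} {α : ℝ} {G : Circle → GL (Fin N) ℂ} {κ : Fin N → ℤ}
    (hκ : IsPartialIndices
      (fun ζ => -((conjMat G ζ)⁻¹ * (G ζ : Matrix (Fin N) (Fin N) ℂ))) κ)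
    {f : Fin N → ClosedDisc → ℂ} (hf : f ∈ kerL m k α G) (j : Fin N) :
    ContDiffOn ℂ ∞ (ext0 (f j)) (closedBall 0 1) := by
  obtain ⟨Bp, Bm, hBp, hBm, hfac⟩ := hκ
  obtain ⟨P, -, hP⟩ := exists_polynomial_of_mem_kerL hBp hBm hfac hf
  have h : ∀ z ∈ closedBall (0 : ℂ) 1, ext0 (f j) z = ∑ i, Bp z j i * (P i).eval z := fun z hz =>
    congrFun (eq_mulVec_of_inv_mulVec_eq (hBp.invertible z hz) (hP z hz)) j
  refine ContDiffOn.congr ?_ h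
  exact ContDiffOn.sum fun i _ => (hBp.contDiffOn j i).mul (P i).differentiable.contDiff.contDiffOn

/-- An element of the kernel whose jet at `1` vanishes up to the largest partial index is zero. -/
lemma eq_zero_of_mem_kerL_of_jet {N m k : ℕ} {α : ℝ} {G : Circle → GL (Fin N) ℂ} {κ : Fin N → ℤ}
    (hκ : IsPartialIndices
      (fun ζ => -((conjMat G ζ)⁻¹ * (G ζ : Matrix (Fin N) (Fin N) ℂ))) κ)
    {d : ℤ} (hd : ∀ j, κ j ≤ d) {f : Fin N → ClosedDisc → ℂ} (hf : f ∈ kerL m k α G)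
    (hjet : ∀ l : ℕ, (l : ℤ) ≤ d → ∀ j,
      iteratedDerivWithin l (ext0 (f j)) (closedBall 0 1) 1 = 0) : f = 0 := by
  have hsm := contDiffOn_of_mem_kerL hκ hf
  obtain ⟨Bp, Bm, hBp, hBm, hfac⟩ := hκ
  obtain ⟨P, hdeg, hP⟩ := exists_polynomial_of_mem_kerL hBp hBm hfac hf
  have hone : (1 : ℂ) ∈ closedBall (0 : ℂ) 1 := by simp
  have hinv := contDiffOn_matrix_inv hBp.contDiffOn hBp.invertible
  have hP0 : ∀ j, P j = 0 := by
    intro j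
    refine polynomial_eq_zero_of_jet (d := d) (fun n hn => hdeg j n ((hd j).trans_lt hn)) 1
      fun l hl => ?_
    rw [← iteratedDerivWithin_polynomial_eval uniqueDiffOn_closedBall hone]
    -- Writing `P j` through `(B⁺)⁻¹` and `f` lets the vanishing jet of `f` pass to `P j`.
    have hEq : EqOn (fun z => (P j).eval z)
        (fun z => ∑ i, (Bp z)⁻¹ j i * ext0 (f i) z) (closedBall 0 1) := fun z hz =>
      (congrFun (hP z hz) j).symm
    rw [iteratedDerivWithin_congr hEq hone, iteratedDerivWithin_fun_sum hone
      uniqueDiffOn_closedBall fun i _ => (((hinv j i).mul (hsm i)).of_le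
        (by norm_cast; exact le_top)) 1 hone]
    refine Finset.sum_eq_zero fun i _ => ?_
    exact iteratedDerivWithin_mul_eq_zero uniqueDiffOn_closedBall hone l (hinv j i) (hsm i)
      fun l' hl' => hjet l' (by omega) i
  funext j z
  have h := congrFun (eq_mulVec_of_inv_mulVec_eq (hBp.invertible z z.2) (hP z z.2)) j
  rw [ext0_apply _ z.2] at h
  simpa [hP0, Matrix.mulVec, dotProduct] using h

end RiemannHilbert

theorem mainTheorem3 (N m k : ℕ) (α : ℝ) (hα₀ : 0 < α) (hα₁ : α < 1)
    (G : Circle → GL (Fin N) ℂ) (hG : RiemannHilbert.SmoothOnCircle G)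
    (κ : Fin N → ℤ)
    (hκ : RiemannHilbert.IsPartialIndices
      (fun ζ => -((RiemannHilbert.conjMat G ζ)⁻¹ * (G ζ : Matrix (Fin N) (Fin N) ℂ))) κ)
    (hL : RiemannHilbert.IsOnto m k α G)
    (ℓ₀ : ℤ) (hℓ₀ : IsGreatest (Set.range κ) ℓ₀) :
    (∀ f ∈ RiemannHilbert.kerL m k α G, ∀ j,
      ContDiffOn ℂ ∞ (RiemannHilbert.ext0 (f j)) (Metric.closedBall 0 1)) ∧
    Set.InjOn (RiemannHilbert.jetAtOne ℓ₀)
      (RiemannHilbert.kerL m k α G : Set (Fin N → RiemannHilbert.ClosedDisc → ℂ)) := by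
  refine ⟨fun f hf => RiemannHilbert.contDiffOn_of_mem_kerL hκ hf, fun f hf g hg hfg => ?_⟩
  have hone : (1 : ℂ) ∈ closedBall (0 : ℂ) 1 := by simp
  -- The kernel is a linear space, so injectivity reduces to a difference with zero jet.
  refine sub_eq_zero.1 (RiemannHilbert.eq_zero_of_mem_kerL_of_jet hκ
    (fun j => hℓ₀.2 (mem_range_self j)) (Submodule.sub_mem _ hf hg) fun l hl j => ?_)
  have hle : ((l : ℕ∞) : WithTop ℕ∞) ≤ ∞ := by norm_cast; exact le_top
  have hsub : EqOn (RiemannHilbert.ext0 ((f - g) j))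
      (RiemannHilbert.ext0 (f j) - RiemannHilbert.ext0 (g j)) (closedBall 0 1) :=
    fun z hz => RiemannHilbert.ext0_sub (f j) (g j) hz
  rw [iteratedDerivWithin_congr hsub hone,
    iteratedDerivWithin_sub hone RiemannHilbert.uniqueDiffOn_closedBall
      (((RiemannHilbert.contDiffOn_of_mem_kerL hκ hf j).of_le hle) 1 hone)
      (((RiemannHilbert.contDiffOn_of_mem_kerL hκ hg j).of_le hle) 1 hone), sub_eq_zero]
  exact congrFun (congrFun hfg ⟨l, hl⟩) j
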